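/- Let $(X,\mathcal{B},m)$ be a non-atomic probability space and $\tau:X\to X$ an invertible (bimeasurable), measure-preserving, ergodic transformation. For $n\ge 1$ let $a_n\in[0,1]$, let $x_n$ be an integer with $|x_n|\ge 1$, let $\gamma_n$ be a probability measure on $\mathbb{Z}$, and put $\nu_n=a_n\delta_{x_n}+(1-a_n)\gamma_n$. Assume that $\sum_{n}(1-a_n)<\infty$ and that the partial sums $\sum_{n=1}^N x_n$ tend to $+\infty$ or tend to $-\infty$ as $N\to\infty$. Let $\mu_n=\nu_1*\nu_2*\cdots*\nu_n$ and $\mu_n f(x)=\sum_{k\in\mathbb{Z}}\mu_n(k)f(\tau^k x)$. Then the sequence $(\mu_n)$ has the strong sweeping out property in $(X,\mathcal{B},m,\tau)$: for every $\varepsilon>0$ there is a set $B\in\mathcal{B}$ with $m(B)<\varepsilon$ such that $$\limsup_{n\to\infty}\mu_n\chi_B(x)=1\ \text{ for a.e. } x\qquad\text{and}\qquad \liminf_{n\to\infty}\mu_n\chi_B(x)=0\ \text{ for a.e. } x.$$ -/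

import Mathlib

open Filter MeasureTheory Topology

/-- A measure is non-atomic if it has no atoms: every measurable set of positive measure has a
measurable subset of strictly smaller, positive measure. (In a general measurable space this is
stronger than the vanishing of the measure on singletons.) -/
def IsNonAtomic {X : Type*} [MeasurableSpace X] (m : Measure X) : Prop :=
  ∀ A : Set X, MeasurableSet A → 0 < m A →
    ∃ B : Set X, MeasurableSet B ∧ B ⊆ A ∧ 0 < m B ∧ m B < m A

/-- The convolution products `ν 0`, `ν 0 ∗ ν 1`, `ν 0 ∗ ν 1 ∗ ν 2`, ... of a sequence of measures
on `ℤ`; the term with index `n` is `ν 0 ∗ ν 1 ∗ ⋯ ∗ ν n`. -/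
noncomputable def convProd (ν : ℕ → Measure ℤ) : ℕ → Measure ℤ
  | 0 => ν 0
  | n + 1 => (convProd ν n).conv (ν (n + 1))

/-- The weighted average `μ f (x) = ∑ k, μ(k) f(τ^k x)` over `k ∈ ℤ`, for an invertible
bimeasurable `τ`. -/
noncomputable def weightedAverage {X : Type*} [MeasurableSpace X] (τ : X ≃ᵐ X) (μ : Measure ℤ)
    (f : X → ℝ) (x : X) : ℝ :=
  ∑' k : ℤ, μ.real {k} * f ((τ.toEquiv ^ k : Equiv.Perm X) x)

/-- The sequence `μ` of (probability) measures on `ℤ` is strong sweeping out for the system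
`(X, m, τ)`: for every `ε > 0` there is a measurable set `B` with `m B < ε` such that
`limsup μ_n χ_B = 1` and `liminf μ_n χ_B = 0` almost everywhere. -/
def StrongSweepingOut {X : Type*} [MeasurableSpace X] (m : Measure X) (τ : X ≃ᵐ X)
    (μ : ℕ → Measure ℤ) : Prop :=
  ∀ ε : ℝ, 0 < ε → ∃ B : Set X, MeasurableSet B ∧ m B < ENNReal.ofReal ε ∧
    (∀ᵐ x ∂m, limsup (fun n : ℕ =>
      weightedAverage τ (μ n) (B.indicator fun _ => (1 : ℝ)) x) atTop = 1) ∧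
    (∀ᵐ x ∂m, liminf (fun n : ℕ =>
      weightedAverage τ (μ n) (B.indicator fun _ => (1 : ℝ)) x) atTop = 0)

/-!
Let `s n` be the partial sums of `x`. Since `∑ n, (1 - a n)` converges, the measures `μ n` are tight
around `s n`, so it suffices to find a small set `B` such that, for almost every point `y`, the
set `{k | τ ^ k y ∈ B}` and its complement both contain, for every `K`, the window of radius `K`
around infinitely many `s n`.

As `s` is unbounded, the Baire category theorem yields a rotation number `α` such that every point
of the circle is a cluster point of `s n • α`; by compactness, every point of the circle is moved
into a given open set by a rotation by some `s n • α` with `N ≤ n ≤ M`, where `M` does not depend on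
the point. The time `-r y` before the orbit of `y` enters a tiny set satisfies `r (τ y) = r y + 1`
except on a tiny set, so `y ↦ r y • α` intertwines long stretches of the orbits of `τ` with that
rotation. One of `L` disjoint open subsets of the circle pulls back to a set of measure at most
`1 / L`, and the orbits of all but a tiny set of points visit it at some time `s n` with
`N ≤ n ≤ M`. Fattening such sets, with measures chosen to decrease fast enough, makes the visits
last for windows of growing radius, and by the Borel–Cantelli lemma they survive the removal of all
later sets. The sets are then disjoint, and `B` is the union of those with even index: the windows
in the others lie outside `B`.
-/

open Set
open scoped ENNReal Function

section Circle

variable {p : ℝ} [Fact (0 < p)] {s : ℕ → ℤ}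

theorem infinite_addCircle : Infinite (AddCircle p) :=
  (AddCircle.equivIco p 0).infinite_iff.2
    (Ico_infinite (lt_add_of_pos_right 0 Fact.out)).to_subtype

theorem exists_zsmul_eq_and_dist_le {k : ℤ} (hk : k ≠ 0) (β θ : AddCircle p) :
    ∃ α : AddCircle p, k • α = θ ∧ dist α β ≤ p / |(k : ℝ)| := by
  obtain ⟨r, hr, hrθ⟩ : ∃ r ∈ Ico 0 (0 + p), (r : AddCircle p) = θ - k • β :=
    (AddCircle.coe_image_Ico_eq p 0).symm.subset (mem_univ _)
  have hk' : (k : ℝ) ≠ 0 := Int.cast_ne_zero.2 hk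
  refine ⟨β + ((r / k : ℝ) : AddCircle p), ?_, ?_⟩
  · rw [smul_add, ← AddCircle.coe_zsmul, zsmul_eq_mul, mul_div_cancel₀ r hk', hrθ,
      add_sub_cancel]
  · calc dist (β + ((r / k : ℝ) : AddCircle p)) β = ‖((r / k : ℝ) : AddCircle p)‖ := by
          rw [dist_eq_norm, add_sub_cancel_left]
      _ ≤ ‖r / k‖ := QuotientAddGroup.norm_mk_le_norm
      _ = r / |(k : ℝ)| := by rw [Real.norm_eq_abs, abs_div, abs_of_nonneg hr.1]
      _ ≤ p / |(k : ℝ)| := by gcongr; linarith [hr.2]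

theorem dense_setOf_exists_zsmul_mem
    (hs : ¬ IsBoundedUnder (· ≤ ·) atTop fun n => |s n|) (N : ℕ) {U : Set (AddCircle p)}
    (hU : U.Nonempty) : Dense {α : AddCircle p | ∃ n ≥ N, s n • α ∈ U} := by
  obtain ⟨θ, hθ⟩ := hU
  refine Metric.dense_iff.2 fun β r hr => ?_
  have hlarge : ∃ᶠ n in atTop, ¬ |s n| ≤ ⌈p / r⌉ := not_eventually.1 fun h => hs ⟨_, h⟩
  obtain ⟨n, hn, hnN⟩ := (hlarge.and_eventually (eventually_ge_atTop N)).exists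
  have hsn : p / r < |(s n : ℝ)| :=
    (Int.le_ceil _).trans_lt (by exact_mod_cast not_le.1 hn)
  have hsn0 : 0 < |(s n : ℝ)| := (div_pos Fact.out hr).trans hsn
  obtain ⟨α, hα, hdist⟩ :=
    exists_zsmul_eq_and_dist_le (Int.cast_ne_zero.1 (abs_pos.1 hsn0)) β θ
  exact ⟨α, hdist.trans_lt ((div_lt_comm₀ hr hsn0).1 hsn), n, hnN, hα ▸ hθ⟩

theorem eventually_residual_forall_mapClusterPt_zsmul
    (hs : ¬ IsBoundedUnder (· ≤ ·) atTop fun n => |s n|) :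
    ∀ᶠ α in residual (AddCircle p), ∀ θ, MapClusterPt θ atTop fun n => s n • α := by
  have hvisit : ∀ U ∈ TopologicalSpace.countableBasis (AddCircle p), ∀ N : ℕ,
      ∀ᶠ α in residual (AddCircle p), ∃ n ≥ N, s n • α ∈ U := fun U hU N => by
    refine residual_of_dense_open ?_ (dense_setOf_exists_zsmul_mem hs N
      (TopologicalSpace.nonempty_of_mem_countableBasis hU))
    simp only [ofPred_exists, ofPred_and]
    exact isOpen_iUnion fun n => isOpen_const.inter <|
      (TopologicalSpace.isOpen_of_mem_countableBasis hU).preimage (continuous_const_smul (s n))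
  filter_upwards [(eventually_countable_ball (TopologicalSpace.countable_countableBasis _)).2
    fun U hU => eventually_countable_forall.2 (hvisit U hU)] with α hα θ
  refine mapClusterPt_iff_frequently.2 fun V hV => ?_
  obtain ⟨U, hU, -, hUV⟩ := (TopologicalSpace.isBasis_countableBasis _).mem_nhds_iff.1 hV
  refine frequently_atTop.2 fun N => ?_
  obtain ⟨n, hn, hnU⟩ := hα U hU N
  exact ⟨n, hn, hUV hnU⟩

end Circle

theorem exists_forall_exists_mem_Icc_add_mem {G : Type*} [TopologicalSpace G] [AddGroup G]
    [ContinuousAdd G] [CompactSpace G] {w : ℕ → G} (hw : ∀ θ, MapClusterPt θ atTop w) (N : ℕ)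
    {U : Set G} (hU : IsOpen U) (hne : U.Nonempty) :
    ∃ M, ∀ y, ∃ n ∈ Finset.Icc N M, y + w n ∈ U := by
  obtain ⟨u, hu⟩ := hne
  set V : ℕ → Set G := fun M => ⋃ n ∈ Finset.Icc N M, {y | y + w n ∈ U}
  have hVmono : Monotone V := fun M M' h =>
    biUnion_subset_biUnion_left (Finset.Icc_subset_Icc_right h)
  have hVopen : ∀ M, IsOpen (V M) := fun M =>
    isOpen_biUnion fun n _ => hU.preimage (continuous_add_const (w n))
  have hVcover : univ ⊆ ⋃ M, V M := fun y _ => by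
    have hnear : {z | y + z ∈ U} ∈ 𝓝 (-y + u) :=
      (hU.preimage (continuous_const_add y)).mem_nhds (by simpa using hu)
    obtain ⟨n, hn, hnU⟩ := frequently_atTop.1 (mapClusterPt_iff_frequently.1 (hw _) _ hnear) N
    exact mem_iUnion.2 ⟨n, mem_biUnion (Finset.mem_Icc.2 ⟨hn, le_rfl⟩) hnU⟩
  obtain ⟨M, hM⟩ := isCompact_univ.elim_directed_cover V hVopen hVcover hVmono.directed_le
  exact ⟨M, fun y => by simpa [V] using hM (mem_univ y)⟩

section Measure

variable {X : Type*} [MeasurableSpace X]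

theorem exists_measure_le_div_card {ι : Type*} {m : Measure X} {I : Finset ι} (hI : I.Nonempty)
    {A : ι → Set X} (hA : ∀ i ∈ I, MeasurableSet (A i)) (hd : (I : Set ι).PairwiseDisjoint A) :
    ∃ i ∈ I, m (A i) ≤ m univ / I.card := by
  refine ENNReal.exists_le_of_sum_le hI ?_
  calc ∑ i ∈ I, m (A i) = m (⋃ i ∈ I, A i) := (measure_biUnion_finset hd hA).symm
    _ ≤ m univ := measure_mono (subset_univ _)
    _ = ∑ _i ∈ I, m univ / I.card := by
      rw [Finset.sum_const, nsmul_eq_mul, ENNReal.mul_div_cancel]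
      · exact Nat.cast_ne_zero.2 hI.card_ne_zero
      · exact ENNReal.natCast_ne_top _

theorem IsNonAtomic.exists_subset_measure_le_half {m : Measure X} [IsFiniteMeasure m]
    (hm : IsNonAtomic m) {A : Set X} (hA : MeasurableSet A) (h0 : 0 < m A) :
    ∃ B ⊆ A, MeasurableSet B ∧ 0 < m B ∧ m B ≤ m A / 2 := by
  obtain ⟨B, hB, hBA, hpos, hlt⟩ := hm A hA h0
  have hdiff : m (A \ B) = m A - m B :=
    measure_sdiff hBA hB.nullMeasurableSet (measure_ne_top _ _)
  rcases le_or_gt (m B) (m A / 2) with h | h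
  · exact ⟨B, hBA, hB, hpos, h⟩
  · refine ⟨A \ B, sdiff_subset, hA.diff hB, hdiff ▸ tsub_pos_of_lt hlt, ?_⟩
    calc m (A \ B) = m A - m B := hdiff
      _ ≤ m A - m A / 2 := tsub_le_tsub_left h.le _
      _ = m A / 2 := ENNReal.sub_half (measure_ne_top _ _)

theorem IsNonAtomic.exists_subset_measure_le {m : Measure X} [IsFiniteMeasure m]
    (hm : IsNonAtomic m) {A : Set X} (hA : MeasurableSet A) (h0 : 0 < m A) {ε : ℝ≥0∞}
    (hε : ε ≠ 0) : ∃ B ⊆ A, MeasurableSet B ∧ 0 < m B ∧ m B ≤ ε := by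
  have hpow : ∀ n : ℕ, ∃ B ⊆ A, MeasurableSet B ∧ 0 < m B ∧ m B ≤ 2⁻¹ ^ n * m A := fun n => by
    induction n with
    | zero => exact ⟨A, Subset.rfl, hA, h0, by simp⟩
    | succ n ih =>
      obtain ⟨B, hBA, hB, hB0, hBn⟩ := ih
      obtain ⟨C, hCB, hC, hC0, hCle⟩ := hm.exists_subset_measure_le_half hB hB0
      refine ⟨C, hCB.trans hBA, hC, hC0, hCle.trans ?_⟩
      rw [pow_succ', mul_assoc, ENNReal.div_eq_inv_mul]
      gcongr
  obtain ⟨n, hn⟩ :=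
    ENNReal.exists_inv_two_pow_lt (ENNReal.div_ne_zero.2 ⟨hε, measure_ne_top m A⟩)
  obtain ⟨B, hBA, hB, hB0, hBn⟩ := hpow n
  exact ⟨B, hBA, hB, hB0, hBn.trans (ENNReal.mul_le_of_le_div hn.le)⟩

end Measure

section EntryTime

variable {X : Type*}

/-- The first time `n ≥ 0` at which the forward orbit of `x` under `f` is in `F`, used as an
integer coordinate along the orbits; it is `0` on the points whose orbit misses `F`. -/
noncomputable def entryTime (f : X → X) (F : Set X) (x : X) : ℕ := sInf {n | f^[n] x ∈ F}

variable {f : X → X} {F : Set X}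

theorem le_entryTime {x : X} {n : ℕ} (hx : ∃ j, f^[j] x ∈ F) (hn : ∀ j < n, f^[j] x ∉ F) :
    n ≤ entryTime f F x :=
  le_csInf hx fun j hj => not_lt.1 fun hjn => hn j hjn hj

theorem entryTime_iterate_add {x : X} {n : ℕ} (hn : n ≤ entryTime f F x) :
    entryTime f F (f^[n] x) + n = entryTime f F x := by
  simpa only [entryTime, Function.iterate_add_apply] using Nat.sInf_add hn

theorem entryTime_le_iff {x : X} {n : ℕ} :
    entryTime f F x ≤ n ↔ (∃ j ≤ n, f^[j] x ∈ F) ∨ ∀ j, f^[j] x ∉ F := by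
  refine ⟨fun h => ?_, ?_⟩
  · by_cases hx : ∃ j, f^[j] x ∈ F
    · exact Or.inl ⟨entryTime f F x, h, Nat.sInf_mem hx⟩
    · exact Or.inr (not_exists.1 hx)
  · rintro (⟨j, hj, hjF⟩ | hx)
    · exact (Nat.sInf_le hjF).trans hj
    · simp [entryTime, hx]

theorem measurable_entryTime [MeasurableSpace X] (hf : Measurable f) (hF : MeasurableSet F) :
    Measurable (entryTime f F) := by
  have hvisit : ∀ j, Measurable fun x => f^[j] x ∈ F := fun j =>
    measurableSet_setOfPred.1 (hf.iterate j hF)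
  refine measurable_of_Iic fun n => ?_
  simp only [preimage, mem_Iic, entryTime_le_iff]
  exact ((Measurable.exists fun j => measurable_const.and (hvisit j)).or
    (Measurable.forall fun j => (hvisit j).not)).setOf

theorem ae_exists_iterate_mem [MeasurableSpace X] {m : Measure X} [IsFiniteMeasure m]
    (hf : Ergodic f m) (hF : MeasurableSet F) (h0 : 0 < m F) : ∀ᵐ x ∂m, ∃ j, f^[j] x ∈ F := by
  set G : Set X := {x | ∃ j, f^[j] x ∈ F}
  have hG : MeasurableSet G :=
    (Measurable.exists fun j => measurableSet_setOfPred.1 (hf.measurable.iterate j hF)).setOf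
  have hpre : f ⁻¹' G ⊆ G := fun x ⟨j, hj⟩ => ⟨j + 1, hj⟩
  have hFG : F ⊆ G := fun x hx => ⟨0, hx⟩
  rcases hf.ae_empty_or_univ_of_preimage_ae_le hG.nullMeasurableSet hpre.eventuallyLE with h | h
  · exact absurd (measure_mono_null hFG (ae_eq_empty.1 h)) h0.ne'
  · exact eventuallyEq_univ.1 h

end EntryTime

section Automorphism

variable {X : Type*} [MeasurableSpace X] {m : Measure X} {τ : X ≃ᵐ X}

theorem zpow_natCast_apply (τ : X ≃ᵐ X) (n : ℕ) (x : X) :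
    (τ.toEquiv ^ (n : ℤ)) x = τ^[n] x := by
  rw [zpow_natCast, ← Equiv.Perm.iterate_eq_pow]
  rfl

theorem zpow_add_apply (τ : X ≃ᵐ X) (k l : ℤ) (x : X) :
    (τ.toEquiv ^ (k + l)) x = (τ.toEquiv ^ k) ((τ.toEquiv ^ l) x) := by
  rw [zpow_add, Equiv.Perm.mul_apply]

theorem measurePreserving_zpow (hτ : MeasurePreserving τ m m) (k : ℤ) :
    MeasurePreserving (τ.toEquiv ^ k) m m := by
  obtain ⟨n, rfl | rfl⟩ := k.eq_nat_or_neg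
  · exact (funext (zpow_natCast_apply τ n)).symm ▸ hτ.iterate n
  · rw [← inv_zpow']
    exact (funext (zpow_natCast_apply τ.symm n)).symm ▸ (hτ.symm τ).iterate n

theorem measure_setOf_exists_zpow_mem_le (hτ : MeasurePreserving τ m m) (I : Finset ℤ)
    {A : Set X} (hA : MeasurableSet A) {ε : ℝ≥0∞} (hAε : m A ≤ ε / I.card) :
    m {x | ∃ k ∈ I, (τ.toEquiv ^ k) x ∈ A} ≤ ε :=
  calc m {x | ∃ k ∈ I, (τ.toEquiv ^ k) x ∈ A} = m (⋃ k ∈ I, (τ.toEquiv ^ k) ⁻¹' A) := by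
        congr 1; ext; simp
    _ ≤ ∑ k ∈ I, m ((τ.toEquiv ^ k) ⁻¹' A) := measure_biUnion_finset_le _ _
    _ = I.card * m A := by
        simp only [(measurePreserving_zpow hτ _).measure_preimage hA.nullMeasurableSet,
          Finset.sum_const, nsmul_eq_mul]
    _ ≤ I.card * (ε / I.card) := by gcongr
    _ ≤ ε := ENNReal.mul_div_le

theorem entryTime_zpow_apply {F : Set X} {x : X} {T : ℕ}
    (hvisit : ∀ k : ℤ, ∃ j, τ^[j] ((τ.toEquiv ^ k) x) ∈ F)
    (hF : ∀ k ∈ Finset.Icc (-T : ℤ) T, (τ.toEquiv ^ k) x ∉ F) {t : ℤ}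
    (ht : t ∈ Finset.Icc (-T : ℤ) T) :
    (entryTime τ F ((τ.toEquiv ^ t) x) : ℤ) = entryTime τ F x - t := by
  rw [Finset.mem_Icc] at ht
  obtain ⟨n, rfl | rfl⟩ := t.eq_nat_or_neg
  · have hn : n ≤ entryTime τ F x := le_entryTime (hvisit 0) fun j hj => by
      rw [← zpow_natCast_apply]
      exact hF j (Finset.mem_Icc.2 (by omega))
    have := entryTime_iterate_add hn
    rw [zpow_natCast_apply]
    omega
  · have hn : n ≤ entryTime τ F ((τ.toEquiv ^ (-n : ℤ)) x) :=
      le_entryTime (hvisit _) fun j hj => by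
        rw [← zpow_natCast_apply, ← zpow_add_apply]
        exact hF _ (Finset.mem_Icc.2 (by omega))
    have := entryTime_iterate_add hn
    rw [← zpow_natCast_apply, ← zpow_add_apply, add_neg_cancel, zpow_zero,
      Equiv.Perm.one_apply] at this
    omega

theorem exists_almost_equivariant [IsProbabilityMeasure m] (hm : IsNonAtomic m)
    (hτ : Ergodic τ m) (T : ℕ) {ε : ℝ≥0∞} (hε : ε ≠ 0) :
    ∃ r : X → ℤ, Measurable r ∧
      m {x | ¬ ∀ t ∈ Finset.Icc (-T : ℤ) T, r ((τ.toEquiv ^ t) x) = r x + t} ≤ ε := by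
  obtain ⟨F, -, hF, hF0, hFε⟩ := hm.exists_subset_measure_le MeasurableSet.univ
    (by simp) (ENNReal.div_ne_zero.2 ⟨hε, ENNReal.natCast_ne_top (Finset.Icc (-T : ℤ) T).card⟩)
  refine ⟨fun x => -entryTime τ F x,
    (measurable_of_countable fun n : ℕ => -(n : ℤ)).comp
      (measurable_entryTime τ.measurable hF), ?_⟩
  have hvisit : ∀ᵐ x ∂m, ∀ k : ℤ, ∃ j, τ^[j] ((τ.toEquiv ^ k) x) ∈ F := ae_all_iff.2 fun k =>
    (measurePreserving_zpow hτ.toMeasurePreserving k).quasiMeasurePreserving.ae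
      (ae_exists_iterate_mem hτ hF hF0)
  refine le_trans (measure_mono_ae ?_)
    (measure_setOf_exists_zpow_mem_le hτ.toMeasurePreserving (Finset.Icc (-T : ℤ) T) hF hFε)
  filter_upwards [hvisit] with x hx hfail
  by_contra hmiss
  refine hfail fun t ht => ?_
  rw [entryTime_zpow_apply hx (fun k hk hkF => hmiss ⟨k, hk, hkF⟩) ht]
  ring

end Automorphism

theorem tsum_le_two_mul_of_succ_le_half {η : ℕ → ℝ≥0∞} (h : ∀ n, η (n + 1) ≤ η n / 2) :
    ∑' n, η n ≤ 2 * η 0 := by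
  have hgeom : ∀ n, η n ≤ 2⁻¹ ^ n * η 0 := fun n => by
    induction n with
    | zero => simp
    | succ n ih =>
      calc η (n + 1) ≤ η n / 2 := h n
        _ ≤ 2⁻¹ ^ n * η 0 / 2 := by gcongr
        _ = 2⁻¹ ^ (n + 1) * η 0 := by rw [ENNReal.div_eq_inv_mul, pow_succ', mul_assoc]
  calc ∑' n, η n ≤ ∑' n, 2⁻¹ ^ n * η 0 := ENNReal.tsum_le_tsum hgeom
    _ = 2 * η 0 := by rw [ENNReal.tsum_mul_right, ENNReal.tsum_geometric_two]

theorem exists_seq_tsum_tail_le {c : ℕ → ℝ≥0∞ → ℝ≥0∞} (hc : ∀ n, ∀ e ≠ 0, c n e ≠ 0) {ε : ℝ≥0∞}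
    (hε : ε ≠ 0) : ∃ η : ℕ → ℝ≥0∞, (∀ n, η n ≠ 0) ∧ ∑' n, η n ≤ ε ∧
      ∀ n, ∑' j, η (j + (n + 1)) ≤ c n (η n) := by
  set η : ℕ → ℝ≥0∞ := fun n => Nat.rec (ε / 2) (fun n e => min e (c n e) / 2) n
  have hsucc : ∀ n, η (n + 1) = min (η n) (c n (η n)) / 2 := fun n => rfl
  have hhalf : ∀ n, η (n + 1) ≤ η n / 2 := fun n => by
    rw [hsucc]
    gcongr
    exact min_le_left _ _
  refine ⟨η, fun n => ?_, ?_, fun n => ?_⟩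
  · induction n with
    | zero => exact (ENNReal.half_pos hε).ne'
    | succ n ih => exact (ENNReal.half_pos (lt_min ih.bot_lt (hc n _ ih).bot_lt).ne').ne'
  · exact (tsum_le_two_mul_of_succ_le_half hhalf).trans ENNReal.mul_div_le
  · calc ∑' j, η (j + (n + 1)) ≤ 2 * η (0 + (n + 1)) :=
          tsum_le_two_mul_of_succ_le_half (η := fun j => η (j + (n + 1))) fun j => by
            rw [add_right_comm]
            exact hhalf (j + (n + 1))
      _ = 2 * (min (η n) (c n (η n)) / 2) := by rw [zero_add, hsucc]
      _ ≤ min (η n) (c n (η n)) := ENNReal.mul_div_le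
      _ ≤ c n (η n) := min_le_right _ _

theorem pairwise_disjoint_sdiff_iUnion_tail {X : Type*} (D : ℕ → Set X) :
    Pairwise (Disjoint on fun K => D K \ ⋃ j, D (j + (K + 1))) := by
  refine (pairwise_disjoint_on _).2 fun i k hik => disjoint_left.2 fun x hi hk => hi.2 ?_
  exact mem_iUnion.2 ⟨k - (i + 1), (Nat.sub_add_cancel hik).symm ▸ hk.1⟩

section Sweeping

variable {X : Type*} [MeasurableSpace X] {m : Measure X} {τ : X ≃ᵐ X} {s : ℕ → ℤ}

theorem exists_small_swept_set [IsProbabilityMeasure m] (hm : IsNonAtomic m) (hτ : Ergodic τ m)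
    (hs : ¬ IsBoundedUnder (· ≤ ·) atTop fun n => |s n|) (N : ℕ) {ε δ : ℝ≥0∞} (hε : ε ≠ 0)
    (hδ : δ ≠ 0) : ∃ A M, MeasurableSet A ∧ m A ≤ ε ∧
      m {x | ¬ ∃ n ∈ Finset.Icc N M, (τ.toEquiv ^ s n) x ∈ A} ≤ δ := by
  obtain ⟨α, hα⟩ :=
    (dense_of_mem_residual (eventually_residual_forall_mapClusterPt_zsmul (p := 1) hs)).nonempty
  obtain ⟨L, hL⟩ := ENNReal.exists_inv_nat_lt hε
  have hL0 : L ≠ 0 := by rintro rfl; simp at hL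
  have : Infinite UnitAddCircle := infinite_addCircle
  obtain ⟨U, hinf, hopen, hdisj⟩ := exists_seq_infinite_isOpen_pairwise_disjoint UnitAddCircle
  choose M hM using fun i =>
    exists_forall_exists_mem_Icc_add_mem hα N (hopen i) (hinf i).nonempty
  set T : ℕ := (Finset.range L).sup fun i => (Finset.Icc N (M i)).sup fun n => (s n).natAbs
  obtain ⟨r, hr, hrT⟩ := exists_almost_equivariant hm hτ T hδ
  have hg : Measurable fun x => r x • α := (measurable_of_countable fun k : ℤ => k • α).comp hr
  obtain ⟨i, hi, hle⟩ := exists_measure_le_div_card (m := m) (Finset.nonempty_range_iff.2 hL0)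
    (fun i _ => hg (hopen i).measurableSet) fun i _ j _ hij => (hdisj hij).preimage _
  refine ⟨_, M i, hg (hopen i).measurableSet, hle.trans ?_, (measure_mono ?_).trans hrT⟩
  · simpa using hL.le
  · refine fun x hmiss hequiv => hmiss ?_
    obtain ⟨n, hn, hnU⟩ := hM i (r x • α)
    have hnT : (s n).natAbs ≤ T := (Finset.le_sup (f := fun n => (s n).natAbs) hn).trans
      (Finset.le_sup (f := fun i => (Finset.Icc N (M i)).sup fun n => (s n).natAbs) hi)
    refine ⟨n, hn, ?_⟩
    rw [mem_preimage, hequiv _ (Finset.mem_Icc.2 (by omega)), add_smul]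
    exact hnU

/-- The points whose orbit, for some `n` with `K ≤ n ≤ M`, is in `D` throughout the window of
radius `K` around time `s n`. -/
def windowVisits (τ : X ≃ᵐ X) (s : ℕ → ℤ) (K M : ℕ) (D : Set X) : Set X :=
  {x | ∃ n ∈ Finset.Icc K M, ∀ k ∈ Finset.Icc (s n - K) (s n + K), (τ.toEquiv ^ k) x ∈ D}

theorem exists_small_windowVisits [IsProbabilityMeasure m] (hm : IsNonAtomic m)
    (hτ : Ergodic τ m) (hs : ¬ IsBoundedUnder (· ≤ ·) atTop fun n => |s n|) (K : ℕ)
    {ε δ : ℝ≥0∞} (hε : ε ≠ 0) (hδ : δ ≠ 0) :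
    ∃ D M, MeasurableSet D ∧ m D ≤ ε ∧ m (windowVisits τ s K M D)ᶜ ≤ δ := by
  set I : Finset ℤ := Finset.Icc (-K) K
  obtain ⟨A, M, hA, hAε, hAδ⟩ := exists_small_swept_set hm hτ hs K
    (ENNReal.div_ne_zero.2 ⟨hε, ENNReal.natCast_ne_top I.card⟩) hδ
  refine ⟨{x | ∃ k ∈ I, (τ.toEquiv ^ k) x ∈ A}, M, ?_,
    measure_setOf_exists_zpow_mem_le hτ.toMeasurePreserving I hA hAε,
    (measure_mono ?_).trans hAδ⟩
  · simp only [ofPred_exists, ofPred_and]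
    exact .iUnion fun k => (MeasurableSet.const _).inter
      ((measurePreserving_zpow hτ.toMeasurePreserving k).measurable hA)
  rintro x hx ⟨n, hn, hnA⟩
  refine hx ⟨n, hn, fun k hk => ⟨s n - k, ?_, ?_⟩⟩
  · rw [Finset.mem_Icc] at hk ⊢
    omega
  · rwa [← zpow_add_apply, sub_add_cancel]

theorem measure_compl_windowVisits_sdiff_le (hτ : MeasurePreserving τ m m) {K M : ℕ}
    (D : Set X) {S : Set X} (hS : MeasurableSet S) {ε : ℝ≥0∞}
    (hSε : m S ≤
      ε / ((Finset.Icc K M).biUnion fun n => Finset.Icc (s n - K) (s n + K)).card) :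
    m (windowVisits τ s K M (D \ S))ᶜ ≤ m (windowVisits τ s K M D)ᶜ + ε := by
  refine (measure_mono fun x hx => ?_).trans ((measure_union_le _ _).trans
    (add_le_add_right (measure_setOf_exists_zpow_mem_le hτ _ hS hSε) _))
  by_contra! h
  obtain ⟨hD, hmiss⟩ := not_or.1 h
  obtain ⟨n, hn, hnD⟩ := notMem_compl_iff.1 hD
  exact hx ⟨n, hn, fun k hk =>
    ⟨hnD k hk, fun hkS => hmiss ⟨k, Finset.mem_biUnion.2 ⟨n, hn, hk⟩, hkS⟩⟩⟩

theorem exists_seq_windowVisits_sdiff_tail [IsProbabilityMeasure m] (hm : IsNonAtomic m)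
    (hτ : Ergodic τ m) (hs : ¬ IsBoundedUnder (· ≤ ·) atTop fun n => |s n|) {ε : ℝ≥0∞}
    (hε : ε ≠ 0) : ∃ (D : ℕ → Set X) (M : ℕ → ℕ), (∀ K, MeasurableSet (D K)) ∧
      ∑' K, m (D K) ≤ ε ∧
      ∀ᵐ x ∂m, ∀ᶠ K in atTop, x ∈ windowVisits τ s K (M K) (D K \ ⋃ j, D (j + (K + 1))) := by
  have hpow : ∀ K : ℕ, (2⁻¹ : ℝ≥0∞) ^ K ≠ 0 := fun K => by simp
  choose! D M hD hDm hvisit using fun (K : ℕ) (e : ℝ≥0∞) (he : e ≠ 0) =>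
    exists_small_windowVisits hm hτ hs K he (hpow K)
  obtain ⟨η, hη0, hηε, htail⟩ := exists_seq_tsum_tail_le
    (c := fun K e => 2⁻¹ ^ K /
      ((Finset.Icc K (M K e)).biUnion fun n => Finset.Icc (s n - K) (s n + K)).card)
    (fun K _ _ => ENNReal.div_ne_zero.2 ⟨hpow K, ENNReal.natCast_ne_top _⟩) hε
  have htailm : ∀ K, m (⋃ j, D (j + (K + 1)) (η (j + (K + 1)))) ≤ ∑' j, η (j + (K + 1)) :=
    fun K => (measure_iUnion_le _).trans (ENNReal.tsum_le_tsum fun j => hDm _ _ (hη0 _))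
  refine ⟨fun K => D K (η K), fun K => M K (η K), fun K => hD _ _ (hη0 K),
    (ENNReal.tsum_le_tsum fun K => hDm _ _ (hη0 K)).trans hηε, ?_⟩
  have hbad : ∀ K, m (windowVisits τ s K (M K (η K))
      (D K (η K) \ ⋃ j, D (j + (K + 1)) (η (j + (K + 1)))))ᶜ ≤ 2⁻¹ ^ K + 2⁻¹ ^ K := fun K =>
    (measure_compl_windowVisits_sdiff_le hτ.toMeasurePreserving _
      (MeasurableSet.iUnion fun j => hD _ _ (hη0 _)) ((htailm K).trans (htail K))).trans
      (add_le_add_left (hvisit _ _ (hη0 K)) _)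
  have hsummable : ∑' K : ℕ, ((2⁻¹ : ℝ≥0∞) ^ K + 2⁻¹ ^ K) ≠ ⊤ := by
    simp [ENNReal.tsum_add]
  filter_upwards [ae_eventually_notMem (ne_top_of_le_ne_top hsummable (ENNReal.tsum_le_tsum hbad))]
    with x hx
  exact hx.mono fun K => notMem_compl_iff.1

/-- A set of integers is thick along `s` if, for every radius `K`, it contains the window of radius
`K` around `s n` for infinitely many `n`. This is a version along `s` of the thick sets of
combinatorics, which contain arbitrarily long intervals. -/
def IsThickAlong (s : ℕ → ℤ) (S : Set ℤ) : Prop :=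
  ∀ K : ℕ, ∃ᶠ n in atTop, Icc (s n - K) (s n + K) ⊆ S

theorem isThickAlong_of_frequently {S : Set ℤ}
    (h : ∃ᶠ K : ℕ in atTop, ∃ n ≥ K, ∀ k ∈ Finset.Icc (s n - K) (s n + K), k ∈ S) :
    IsThickAlong s S := fun K => frequently_atTop.2 fun N => by
  obtain ⟨K', hK', n, hn, hwindow⟩ := frequently_atTop.1 h (max K N)
  refine ⟨n, by omega, fun k hk => hwindow k (Finset.mem_Icc.2 ?_)⟩
  rw [mem_Icc] at hk
  omega

theorem exists_isThickAlong_visits [IsProbabilityMeasure m] (hm : IsNonAtomic m)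
    (hτ : Ergodic τ m) (hs : ¬ IsBoundedUnder (· ≤ ·) atTop fun n => |s n|) {ε : ℝ≥0∞}
    (hε : ε ≠ 0) : ∃ B, MeasurableSet B ∧ m B ≤ ε ∧ ∀ᵐ x ∂m,
      IsThickAlong s {k | (τ.toEquiv ^ k) x ∈ B} ∧
      IsThickAlong s {k | (τ.toEquiv ^ k) x ∈ B}ᶜ := by
  obtain ⟨D, M, hD, hDε, hvisit⟩ := exists_seq_windowVisits_sdiff_tail hm hτ hs hε
  set E : ℕ → Set X := fun K => D K \ ⋃ j, D (j + (K + 1))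
  have hE : ∀ K, MeasurableSet (E K) := fun K => (hD K).diff (.iUnion fun j => hD _)
  refine ⟨⋃ (K) (_ : Even K), E K, .iUnion fun K => .iUnion fun _ => hE K, ?_, ?_⟩
  · calc m (⋃ (K) (_ : Even K), E K) ≤ m (⋃ K, D K) := measure_mono <|
          iUnion_mono fun K => iUnion_subset fun _ => sdiff_subset
      _ ≤ ∑' K, m (D K) := measure_iUnion_le _
      _ ≤ ε := hDε
  filter_upwards [hvisit] with x hx
  constructor
  · refine isThickAlong_of_frequently <| (Nat.frequently_even.and_eventually hx).mono ?_
    rintro K ⟨hK, n, hn, hwindow⟩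
    exact ⟨n, (Finset.mem_Icc.1 hn).1, fun k hk => mem_iUnion₂.2 ⟨K, hK, hwindow k hk⟩⟩
  · refine isThickAlong_of_frequently <| (Nat.frequently_odd.and_eventually hx).mono ?_
    rintro K ⟨hK, n, hn, hwindow⟩
    refine ⟨n, (Finset.mem_Icc.1 hn).1, fun k hk hkB => ?_⟩
    obtain ⟨K', hK', hkK'⟩ := mem_iUnion₂.1 hkB
    have hne : K' ≠ K := by
      rintro rfl
      exact Nat.not_even_iff_odd.2 hK hK'
    exact disjoint_left.1 (pairwise_disjoint_sdiff_iUnion_tail D hne) hkK' (hwindow k hk)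

end Sweeping

/-- The sequence `μ` is tight after `μ n` is recentred at `s n`: up to an arbitrarily small mass,
`μ n` is carried, for all large `n`, by a window around `s n` of radius independent of `n`. -/
def IsTightAround (μ : ℕ → Measure ℤ) (s : ℕ → ℤ) : Prop :=
  ∀ δ : ℝ≥0∞, δ ≠ 0 → ∃ K : ℕ, ∀ᶠ n in atTop, μ n (Icc (s n - K) (s n + K))ᶜ ≤ δ

section Averages

variable {μ : ℕ → Measure ℤ} {s : ℕ → ℤ} {S : Set ℤ}

theorem IsTightAround.liminf_measure_compl (hμ : IsTightAround μ s) (hS : IsThickAlong s S) :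
    liminf (fun n => μ n Sᶜ) atTop = 0 := by
  refine nonpos_iff_eq_zero.1 (le_of_forall_gt_imp_ge_of_dense fun δ hδ => ?_)
  obtain ⟨K, hK⟩ := hμ δ hδ.ne'
  exact liminf_le_of_frequently_le' <| ((hS K).and_eventually hK).mono fun n ⟨hn, hle⟩ =>
    (measure_mono (compl_subset_compl.2 hn)).trans hle

theorem IsTightAround.limsup_measure [∀ n, IsProbabilityMeasure (μ n)]
    (hμ : IsTightAround μ s) (hS : IsThickAlong s S) :
    limsup (fun n => μ n S) atTop = 1 := by
  have hcompl : ∀ n, μ n S = 1 - μ n Sᶜ := fun n => by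
    rw [← prob_compl_eq_one_sub S.to_countable.measurableSet.compl, compl_compl]
  simp only [hcompl]
  rw [ENNReal.limsup_const_sub _ _ ENNReal.one_ne_top, hμ.liminf_measure_compl hS, tsub_zero]

theorem weightedAverage_indicator {X : Type*} [MeasurableSpace X] (τ : X ≃ᵐ X) (μ : Measure ℤ)
    [IsFiniteMeasure μ] (B : Set X) (x : X) :
    weightedAverage τ μ (B.indicator fun _ => (1 : ℝ)) x =
      (μ {k : ℤ | (τ.toEquiv ^ k) x ∈ B}).toReal := by
  set V := {k : ℤ | (τ.toEquiv ^ k) x ∈ B}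
  have hV : MeasurableSet V := V.to_countable.measurableSet
  calc weightedAverage τ μ (B.indicator fun _ => (1 : ℝ)) x
      = ∫ k, V.indicator (fun _ => (1 : ℝ)) k ∂μ :=
        (integral_countable ((integrable_const _).indicator hV)).symm
    _ = μ.real V := by rw [integral_indicator_const _ hV, smul_eq_mul, mul_one]

theorem IsTightAround.strongSweepingOut [∀ n, IsProbabilityMeasure (μ n)]
    (hμ : IsTightAround μ s) (hs : ¬ IsBoundedUnder (· ≤ ·) atTop fun n => |s n|) {X : Type*}
    [MeasurableSpace X] {m : Measure X} [IsProbabilityMeasure m] (hm : IsNonAtomic m)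
    {τ : X ≃ᵐ X} (hτ : Ergodic τ m) : StrongSweepingOut m τ μ := by
  intro ε hε
  have hbdd : ∀ V : Set ℤ, ∀ᶠ n in atTop, μ n V ≤ 1 := fun V => .of_forall fun n => prob_le_one
  obtain ⟨B, hB, hBε, hthick⟩ := exists_isThickAlong_visits hm hτ hs
    (ENNReal.half_pos (ENNReal.ofReal_pos.2 hε).ne').ne'
  refine ⟨B, hB, hBε.trans_lt (ENNReal.half_lt_self (ENNReal.ofReal_pos.2 hε).ne'
    ENNReal.ofReal_ne_top), ?_, ?_⟩
  · filter_upwards [hthick] with x hx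
    simp only [weightedAverage_indicator]
    rw [ENNReal.limsup_toReal_eq ENNReal.one_ne_top (hbdd _), hμ.limsup_measure hx.1,
      ENNReal.toReal_one]
  · filter_upwards [hthick] with x hx
    simp only [weightedAverage_indicator]
    have hliminf := hμ.liminf_measure_compl hx.2
    rw [compl_compl] at hliminf
    rw [ENNReal.liminf_toReal_eq ENNReal.one_ne_top (hbdd _), hliminf, ENNReal.toReal_zero]

end Averages

section Convolution

theorem conv_apply_le_add_compl_singleton {G : Type*} [AddMonoid G] [MeasurableSpace G]
    [MeasurableAdd₂ G] (μ ν : Measure G) [IsProbabilityMeasure μ] [IsProbabilityMeasure ν]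
    {T : Set G} (hT : MeasurableSet T) (x : G) :
    μ.conv ν T ≤ μ ((· + x) ⁻¹' T) + ν {x}ᶜ := by
  have hsub : (fun p : G × G => p.1 + p.2) ⁻¹' T ⊆
      ((· + x) ⁻¹' T) ×ˢ univ ∪ univ ×ˢ {x}ᶜ := by
    rintro ⟨y, z⟩ hyz
    rcases eq_or_ne z x with rfl | hz
    · exact Or.inl ⟨hyz, mem_univ _⟩
    · exact Or.inr ⟨mem_univ _, hz⟩
  calc μ.conv ν T = μ.prod ν ((fun p : G × G => p.1 + p.2) ⁻¹' T) :=
        Measure.map_apply measurable_add hT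
    _ ≤ μ.prod ν (((· + x) ⁻¹' T) ×ˢ univ) + μ.prod ν (univ ×ˢ {x}ᶜ) :=
        (measure_mono hsub).trans (measure_union_le _ _)
    _ = μ ((· + x) ⁻¹' T) + ν {x}ᶜ := by
        rw [Measure.prod_prod, Measure.prod_prod, measure_univ, measure_univ, mul_one, one_mul]

theorem exists_measure_compl_Icc_le (μ : Measure ℤ) [IsFiniteMeasure μ] (c : ℤ) {δ : ℝ≥0∞}
    (hδ : δ ≠ 0) : ∃ K : ℕ, μ (Icc (c - K) (c + K))ᶜ ≤ δ := by
  have htight := (tendsto_measure_compl_closedBall_of_isTightMeasureSet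
    (isTightMeasureSet_singleton (μ := μ)) c).comp tendsto_natCast_atTop_atTop
  obtain ⟨K, hK⟩ := (htight.eventually_le_const hδ.bot_lt).exists
  exact ⟨K, by simpa [Int.closedBall_eq_Icc] using hK⟩

variable {ν : ℕ → Measure ℤ} {x : ℕ → ℤ}

theorem isProbabilityMeasure_convProd (hν : ∀ n, IsProbabilityMeasure (ν n)) (n : ℕ) :
    IsProbabilityMeasure (convProd ν n) := by
  induction n with
  | zero => exact hν 0
  | succ n ih =>
    have := hν (n + 1)
    exact Measure.probabilitymeasure_of_probabilitymeasures_conv _ _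

theorem convProd_add_compl_Icc_le (hν : ∀ n, IsProbabilityMeasure (ν n)) (N K j : ℕ) :
    convProd ν (N + j) (Icc (∑ i ∈ Finset.range (N + j + 1), x i - K)
        (∑ i ∈ Finset.range (N + j + 1), x i + K))ᶜ ≤
      convProd ν N (Icc (∑ i ∈ Finset.range (N + 1), x i - K)
        (∑ i ∈ Finset.range (N + 1), x i + K))ᶜ +
      ∑ i ∈ Finset.range j, ν (i + (N + 1)) {x (i + (N + 1))}ᶜ := by
  induction j with
  | zero => simp
  | succ j ih =>
    have := isProbabilityMeasure_convProd hν (N + j)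
    rw [Finset.sum_range_succ _ j, ← add_assoc, ← add_assoc,
      show j + (N + 1) = N + j + 1 by ring]
    refine (conv_apply_le_add_compl_singleton _ _ (to_countable _).measurableSet
      (x (N + j + 1))).trans (add_le_add_left ((congrArg (convProd ν (N + j)) ?_).trans_le ih) _)
    rw [preimage_compl, preimage_add_const_Icc, Finset.sum_range_succ _ (N + j + 1)]
    congr 2 <;> ring

theorem isTightAround_convProd (hν : ∀ n, IsProbabilityMeasure (ν n))
    (hmass : ∑' n, ν n {x n}ᶜ ≠ ⊤) :
    IsTightAround (convProd ν) fun n => ∑ i ∈ Finset.range (n + 1), x i := fun δ hδ => by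
  have := isProbabilityMeasure_convProd hν
  have htail := (ENNReal.tendsto_sum_nat_add _ hmass).comp (tendsto_add_atTop_nat 1)
  obtain ⟨N, hN⟩ := (htail.eventually_le_const (ENNReal.half_pos hδ)).exists
  obtain ⟨K, hK⟩ := exists_measure_compl_Icc_le (convProd ν N)
    (∑ i ∈ Finset.range (N + 1), x i) (ENNReal.half_pos hδ).ne'
  refine ⟨K, eventually_atTop.2 ⟨N, fun n hn => ?_⟩⟩
  obtain ⟨j, rfl⟩ := Nat.exists_eq_add_of_le hn
  calc _ ≤ _ + ∑ i ∈ Finset.range j, ν (i + (N + 1)) {x (i + (N + 1))}ᶜ :=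
        convProd_add_compl_Icc_le hν N K j
    _ ≤ δ / 2 + δ / 2 := add_le_add hK ((ENNReal.sum_le_tsum _).trans hN)
    _ = δ := ENNReal.add_halves δ

theorem isProbabilityMeasure_ofReal_smul_add {Ω : Type*} [MeasurableSpace Ω] {μ γ : Measure Ω}
    [IsProbabilityMeasure μ] [IsProbabilityMeasure γ] {t : ℝ} (ht : 0 ≤ t ∧ t ≤ 1) :
    IsProbabilityMeasure (ENNReal.ofReal t • μ + ENNReal.ofReal (1 - t) • γ) := by
  constructor
  simp [← ENNReal.ofReal_add ht.1 (sub_nonneg.2 ht.2)]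

theorem ofReal_smul_dirac_add_compl_singleton_le {Ω : Type*} [MeasurableSpace Ω]
    [MeasurableSingletonClass Ω] (t : ℝ) (x : Ω) (γ : Measure Ω) [IsProbabilityMeasure γ] :
    (ENNReal.ofReal t • Measure.dirac x + ENNReal.ofReal (1 - t) • γ) {x}ᶜ ≤
      ENNReal.ofReal (1 - t) := by
  simpa using mul_le_of_le_one_right' prob_le_one

end Convolution

theorem not_isBoundedUnder_abs_of_tendsto {u : ℕ → ℤ}
    (hu : Tendsto u atTop atTop ∨ Tendsto u atTop atBot) :
    ¬ IsBoundedUnder (· ≤ ·) atTop fun n => |u n| :=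
  not_isBoundedUnder_of_tendsto_atTop <|
    hu.elim tendsto_abs_atTop_atTop.comp tendsto_abs_atBot_atTop.comp

theorem corollary4p2p2_general {x : ℕ → ℤ} {ν : ℕ → Measure ℤ}
    (hν : ∀ n, IsProbabilityMeasure (ν n)) (hmass : ∑' n, ν n {x n}ᶜ ≠ ⊤)
    (hunbdd : ¬ IsBoundedUnder (· ≤ ·) atTop fun N => |∑ n ∈ Finset.range N, x n|)
    {X : Type*} [MeasurableSpace X] {m : Measure X} [IsProbabilityMeasure m]
    (hm : IsNonAtomic m) {τ : X ≃ᵐ X} (hτ : Ergodic τ m) :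
    StrongSweepingOut m τ (convProd ν) := by
  have := isProbabilityMeasure_convProd hν
  refine (isTightAround_convProd hν hmass).strongSweepingOut (fun hbdd => hunbdd ?_) hm hτ
  rw [← map_add_atTop_eq_nat 1]
  exact hbdd

theorem corollary4p2p2
    (a : ℕ → ℝ) (x : ℕ → ℤ) (γ ν : ℕ → Measure ℤ)
    (ha : ∀ n, 0 ≤ a n ∧ a n ≤ 1)
    (hγ : ∀ n, IsProbabilityMeasure (γ n))
    (hν : ∀ n, ν n =
      ENNReal.ofReal (a n) • Measure.dirac (x n) + ENNReal.ofReal (1 - a n) • γ n)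
    (hsum : Summable fun n => 1 - a n)
    (hx : ∀ n, 1 ≤ |x n|)
    (hdiv : Tendsto (fun N : ℕ => ∑ n ∈ Finset.range N, x n) atTop atTop ∨
      Tendsto (fun N : ℕ => ∑ n ∈ Finset.range N, x n) atTop atBot)
    {X : Type*} [MeasurableSpace X] (m : Measure X) [IsProbabilityMeasure m]
    (hm : IsNonAtomic m) (τ : X ≃ᵐ X) (hτ : Ergodic τ m) :
    StrongSweepingOut m τ (convProd ν) := by
  have hprob : ∀ n, IsProbabilityMeasure (ν n) := fun n =>
    hν n ▸ isProbabilityMeasure_ofReal_smul_add (ha n)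
  have hmass : ∀ n, ν n {x n}ᶜ ≤ ENNReal.ofReal (1 - a n) := fun n =>
    hν n ▸ ofReal_smul_dirac_add_compl_singleton_le (a n) (x n) (γ n)
  exact corollary4p2p2_general hprob
    (ne_top_of_le_ne_top hsum.tsum_ofReal_ne_top (ENNReal.tsum_le_tsum hmass))
    (not_isBoundedUnder_abs_of_tendsto hdiv) hm hτ
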